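/- **Setting.** Let $K\ge 2$ and $d\ge 0$ be integers, let $\varepsilon>0$, and let $X=(X_t)_{t\ge 0}$ be an $\mathbb{R}^d$-valued càdlàg process on a probability space. Let $Z_0,\dots,Z_K$ be exponential random variables with parameter $1$, independent of each other and of the process $X$. Let $\alpha_0,\dots,\alpha_K:\mathbb{R}^d\to[0,\infty)$ be continuous, put $A_i(s)=\int_0^s\alpha_i(X_r)\,dr$, and assume that $\lim_{s\to\infty}A_i(s)=\infty$ almost surely for every $i=0,\dots,K$. Put $f_i(x)=\alpha_i(X_x)e^{-A_i(x)}$, $\eta_i=\inf\{s\ge 0: A_i(s)\ge Z_i\}$ for $0\le i\le K$, and $\tau_i=\min(\eta_0,\eta_i)$ for $1\le i\le K$. Let $P_K$ be the set of all permutations $j=(j_1,\dots,j_K)$ of $(1,\dots,K)$. For $i\neq j$ in $\{1,\dots,K\}$ let $$I_{ij}=\int_0^\infty \alpha_i(X_x)\,e^{-A_i(x)-A_j(x+\varepsilon)-A_0(x+\varepsilon)}\,dx ,$$ and for $j\in P_K$ let $$J_j=\int_0^\infty f_{j_1}(x_1)\int_{x_1+\varepsilon}^\infty f_{j_2}(x_2)\cdots\int_{x_{K-2}+\varepsilon}^\infty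 f_{j_{K-1}}(x_{K-1})\,e^{-A_{j_K}(x_{K-1}+\varepsilon)-A_0(x_{K-1}+\varepsilon)}\,dx_{K-1}\cdots dx_2\,dx_1 .$$ **Theorem (Bounds on the Market Failure Probability).** Let $p=\mathbb{P}\left(|\tau_i-\tau_j|<\varepsilon\text{ for some } i\neq j \text{ in } \{1,\dots,K\}\right)$. For every subset $S\subseteq P_K$, $$p\le\min\left[\binom K2-\sum_{i=1}^K\sum_{j\neq i}\mathbb{E}\left[I_{ij}\right],\; 1-\mathbb{E}\Big[\sum_{j\in S}J_j\Big]\right],$$ and $$p\ge\max\left[1-\mathbb{E}\Big[e^{-A_0((K-1)\varepsilon)}\sum_{j\in P_K}\exp\Big(-\sum_{i=1}^{K-1}A_{j_{i+1}}(i\varepsilon)\Big)\Big],\; 1-\min_{i\neq j}\mathbb{E}\left[I_{ij}+I_{ji}\right]\right].$$ -/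

import Mathlib

open MeasureTheory ProbabilityTheory Filter Topology
open scoped NNReal

noncomputable section

namespace MarketFailure

/-- A path on `[0, ∞)` is càdlàg: right-continuous with left limits. -/
def IsCadlag {E : Type*} [TopologicalSpace E] (x : ℝ≥0 → E) : Prop :=
  ∀ t : ℝ≥0, ContinuousWithinAt x (Set.Ici t) t ∧ ∃ l : E, Tendsto x (𝓝[<] t) (𝓝 l)

section Path

variable {E : Type*}

/-- `A(s) = ∫₀ˢ a(x_r) dr`, the cumulative intensity along the path `x`. -/
def cumIntensity (a : E → ℝ) (x : ℝ≥0 → E) (s : ℝ) : ℝ :=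
  ∫ r in (0 : ℝ)..s, a (x r.toNNReal)

/-- `f(s) = a(x_s) exp (-A(s))`, the conditional default density along the path `x`. -/
def condDensity (a : E → ℝ) (x : ℝ≥0 → E) (s : ℝ) : ℝ :=
  a (x s.toNNReal) * Real.exp (-cumIntensity a x s)

/-- `η = inf {s ≥ 0 : A(s) ≥ z}`, the first time the cumulative intensity reaches level `z`
(a genuine real number as soon as `A(s) → ∞`). -/
def eventTime (a : E → ℝ) (x : ℝ≥0 → E) (z : ℝ) : ℝ :=
  sInf {s : ℝ | 0 ≤ s ∧ z ≤ cumIntensity a x s}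

/-- `∫₀^∞ a(x_s) exp (-A_a(s) - A_b(s + ε) - A_c(s + ε)) ds`. -/
def pairIntegral (a b c : E → ℝ) (ε : ℝ) (x : ℝ≥0 → E) : ℝ :=
  ∫ s in Set.Ioi (0 : ℝ),
    a (x s.toNNReal) * Real.exp (-cumIntensity a x s - cumIntensity b x (s + ε)
      - cumIntensity c x (s + ε))

/-- The iterated integral attached to a list `[a₁, …, a_K]` of intensities, a stress
intensity `c`, and a starting point `y`:
`∫_y^∞ f₁(x₁) ∫_{x₁+ε}^∞ f₂(x₂) ⋯ ∫_{x_{K-2}+ε}^∞ f_{K-1}(x_{K-1})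
  exp (-A_K(x_{K-1} + ε) - A_c(x_{K-1} + ε)) dx_{K-1} ⋯ dx₁`.
It is used for lists with at least two entries; the value on the empty list is immaterial. -/
def orderedIntegral (c : E → ℝ) (ε : ℝ) (x : ℝ≥0 → E) : List (E → ℝ) → ℝ → ℝ
  | [], _ => 1
  | [a], y => Real.exp (-cumIntensity a x y - cumIntensity c x y)
  | a :: b :: l, y =>
      ∫ s in Set.Ioi y, condDensity a x s * orderedIntegral c ε x (b :: l) (s + ε)

end Path

section Market

variable {E : Type*} {Ω : Type*} {K : ℕ}

/-- The default time `τᵢ = min (η₀, ηᵢ)` of bank `i`. Index `0` in `Fin (K + 1)` is the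
market-wide stress event, and bank `i : Fin K` has index `i.succ`. -/
def defaultTime (α : Fin (K + 1) → E → ℝ) (X : ℝ≥0 → Ω → E) (Z : Fin (K + 1) → Ω → ℝ)
    (i : Fin K) (ω : Ω) : ℝ :=
  min (eventTime (α 0) (fun t => X t ω) (Z 0 ω))
    (eventTime (α i.succ) (fun t => X t ω) (Z i.succ ω))

/-- The market failure event: two distinct banks default within less than `ε`. -/
def failureEvent (α : Fin (K + 1) → E → ℝ) (X : ℝ≥0 → Ω → E) (Z : Fin (K + 1) → Ω → ℝ)
    (ε : ℝ) : Set Ω :=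
  {ω | ∃ i j : Fin K, i ≠ j ∧ |defaultTime α X Z i ω - defaultTime α X Z j ω| < ε}

/-- The ordered pairs of distinct banks. -/
def bankPairs (K : ℕ) : Finset (Fin K × Fin K) := (Finset.univ : Finset (Fin K)).offDiag

theorem bankPairs_nonempty {K : ℕ} (hK : 2 ≤ K) : (bankPairs K).Nonempty :=
  ⟨(⟨0, by omega⟩, ⟨1, by omega⟩), by simp [bankPairs]⟩

end Market

end MarketFailure

end

/-! Fix a path of the state process. Given the path, the event times `η_k` are independent, with
tails `exp (-A_k(t))` and densities `f_k` on `(0, ∞)`. If `τ_i + ε ≤ τ_j`, then `η_i < η_0`, since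
`τ_j ≤ η_0`. So among banks defaulting in a given order with gaps at least `ε`, only the last can be
hit by the stress event. Integrating out the event times one at a time gives the nested integral
`J_j`, and `I_ij` for two banks (`pi_eventLaw_spacedSet`). Averaging over paths yields the
probability of each spaced order (`IsMarket.measureReal_spacedEvent`). Absence of failure is the
disjoint union of the spaced orders of all banks. The upper bounds come from a union bound over
pairs and from keeping only the orders in `S`. The lower bounds come from relaxing each order to a
product of tails, the default in position `k` (from `0`) being at least `kε`, and from looking at
one pair only. -/

namespace MarketFailure

open Set

/-! ### Joint measurability of right-continuous functions -/

/-- A real function of two variables that is measurable in the first and right-continuous in the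
second is jointly measurable. -/
theorem measurable_uncurry_of_continuousWithinAt_Ici {S : Type*} [MeasurableSpace S]
    {F : S → ℝ → ℝ} (hF : ∀ r, Measurable fun s => F s r)
    (hc : ∀ s r, ContinuousWithinAt (F s) (Ici r) r) : Measurable (Function.uncurry F) := by
  -- The next point to the right of `r` on the grid of mesh `1 / (n + 1)`. It depends on `r` through
  -- an integer only, and it tends to `r` from the right.
  let g : ℕ → ℝ → ℝ := fun n r => ((⌊((n : ℝ) + 1) * r⌋ : ℝ) + 1) / (n + 1)
  have hg : ∀ n r, r ≤ g n r ∧ g n r ≤ r + 1 / ((n : ℝ) + 1) := by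
    intro n r
    have hn : (0 : ℝ) < n + 1 := by positivity
    constructor
    · rw [le_div_iff₀ hn]
      linarith [Int.lt_floor_add_one (((n : ℝ) + 1) * r)]
    · have h1 : (1 / ((n : ℝ) + 1)) * (n + 1) = 1 := one_div_mul_cancel hn.ne'
      rw [div_le_iff₀ hn, add_mul r, h1]
      linarith [Int.floor_le (((n : ℝ) + 1) * r)]
  have hlim : ∀ r, Tendsto (fun n => g n r) atTop (𝓝[≥] r) := by
    intro r
    refine tendsto_nhdsWithin_iff.2 ⟨?_, Eventually.of_forall fun n => (hg n r).1⟩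
    refine tendsto_of_tendsto_of_tendsto_of_le_of_le tendsto_const_nhds ?_
      (fun n => (hg n r).1) (fun n => (hg n r).2)
    simpa using tendsto_const_nhds.add (tendsto_one_div_add_atTop_nhds_zero_nat (𝕜 := ℝ))
  refine measurable_of_tendsto_metrizable (f := fun (n : ℕ) (p : S × ℝ) => F p.1 (g n p.2)) ?_ ?_
  · intro n
    have h1 : Measurable fun q : S × ℤ => F q.1 (((q.2 : ℝ) + 1) / (n + 1)) :=
      measurable_from_prod_countable_left fun k : ℤ => hF (((k : ℝ) + 1) / (n + 1))
    have h2 : Measurable fun p : S × ℝ => (p.1, ⌊((n : ℝ) + 1) * p.2⌋) :=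
      measurable_fst.prodMk (Int.measurable_floor.comp (measurable_snd.const_mul _))
    exact h1.comp h2
  · rw [tendsto_pi_nhds]
    rintro ⟨s, r⟩
    exact (hc s r).tendsto.comp (hlim r)

/-! ### Cumulative intensity and event time along a fixed path -/

section Path

variable {E : Type*} {a : E → ℝ} {x : ℝ≥0 → E}

theorem cumIntensity_zero : cumIntensity a x 0 = 0 := by simp [cumIntensity]

theorem condDensity_nonneg (ha0 : ∀ e, 0 ≤ a e) (t : ℝ) : 0 ≤ condDensity a x t :=
  mul_nonneg (ha0 _) (Real.exp_nonneg _)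

theorem eventTime_nonneg (a : E → ℝ) (x : ℝ≥0 → E) (z : ℝ) : 0 ≤ eventTime a x z :=
  Real.sInf_nonneg fun _ hs => hs.1

end Path

section Cadlag

variable {E : Type*} [TopologicalSpace E] {a : E → ℝ} {x : ℝ≥0 → E}

theorem IsCadlag.continuousWithinAt_comp (hx : IsCadlag x) (ha : Continuous a) (r : ℝ) :
    ContinuousWithinAt (fun s : ℝ => a (x s.toNNReal)) (Ici r) r :=
  ha.continuousAt.comp_continuousWithinAt <|
    (hx r.toNNReal).1.comp (f := Real.toNNReal) continuous_real_toNNReal.continuousWithinAt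
      fun _ hs => Real.toNNReal_le_toNNReal hs

theorem IsCadlag.exists_tendsto_left (hx : IsCadlag x) (ha : Continuous a) (r : ℝ) :
    ∃ l, Tendsto (fun s : ℝ => a (x s.toNNReal)) (𝓝[<] r) (𝓝 l) := by
  rcases le_or_gt r 0 with hr | hr
  · refine ⟨a (x 0), tendsto_const_nhds.congr' ?_⟩
    filter_upwards [self_mem_nhdsWithin] with s hs
    rw [Real.toNNReal_of_nonpos (hs.le.trans hr)]
  · obtain ⟨l, hl⟩ := (hx r.toNNReal).2
    refine ⟨a l, (ha.tendsto l).comp (hl.comp ?_)⟩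
    refine tendsto_nhdsWithin_iff.2
      ⟨(continuous_real_toNNReal.tendsto r).mono_left nhdsWithin_le_nhds, ?_⟩
    filter_upwards [self_mem_nhdsWithin] with s hs
    exact (Real.toNNReal_lt_toNNReal_iff hr).2 hs

theorem IsCadlag.measurable_comp (hx : IsCadlag x) (ha : Continuous a) :
    Measurable fun s : ℝ => a (x s.toNNReal) :=
  (measurable_uncurry_of_continuousWithinAt_Ici (S := Unit)
    (F := fun _ s => a (x s.toNNReal)) (fun _ => measurable_const)
    fun _ r => hx.continuousWithinAt_comp ha r).comp (measurable_prodMk_left (x := ()))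

/-- One-sided limits bound the function on each side of `r`, so the neighbourhood filter is split
into its left and right halves. -/
theorem IsCadlag.locallyIntegrable_comp (hx : IsCadlag x) (ha : Continuous a) :
    LocallyIntegrable (fun s : ℝ => a (x s.toNNReal)) := by
  intro r
  obtain ⟨l, hl⟩ := hx.exists_tendsto_left ha r
  have hm := (hx.measurable_comp ha).aestronglyMeasurable (μ := volume)
  rw [← nhdsLT_sup_nhdsGE, IntegrableAtFilter.sup_iff]
  exact ⟨Measure.FiniteAtFilter.integrableAtFilter_of_tendsto ⟨univ, univ_mem, hm.restrict⟩
      (volume.finiteAt_nhdsWithin _ _) hl,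
    Measure.FiniteAtFilter.integrableAtFilter_of_tendsto ⟨univ, univ_mem, hm.restrict⟩
      (volume.finiteAt_nhdsWithin _ _) (hx.continuousWithinAt_comp ha r).tendsto⟩

theorem IsCadlag.intervalIntegrable_comp (hx : IsCadlag x) (ha : Continuous a) (s t : ℝ) :
    IntervalIntegrable (fun s : ℝ => a (x s.toNNReal)) volume s t :=
  ((hx.locallyIntegrable_comp ha).integrableOn_isCompact isCompact_uIcc).intervalIntegrable

theorem IsCadlag.continuous_cumIntensity (hx : IsCadlag x) (ha : Continuous a) :
    Continuous (cumIntensity a x) :=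
  intervalIntegral.continuous_primitive (hx.intervalIntegrable_comp ha) 0

theorem IsCadlag.monotone_cumIntensity (hx : IsCadlag x) (ha : Continuous a)
    (ha0 : ∀ e, 0 ≤ a e) : Monotone (cumIntensity a x) := by
  intro s t hst
  have := intervalIntegral.integral_interval_sub_left (hx.intervalIntegrable_comp ha 0 t)
    (hx.intervalIntegrable_comp ha 0 s)
  have h2 : 0 ≤ ∫ r in s..t, a (x r.toNNReal) :=
    intervalIntegral.integral_nonneg hst fun _ _ => ha0 _
  unfold cumIntensity
  linarith

/-- The integrand is only right-continuous, so only a right derivative is available; it suffices for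
the fundamental theorem of calculus. -/
theorem IsCadlag.hasDerivWithinAt_cumIntensity (hx : IsCadlag x) (ha : Continuous a) (t : ℝ) :
    HasDerivWithinAt (cumIntensity a x) (a (x t.toNNReal)) (Ioi t) t :=
  (intervalIntegral.integral_hasDerivWithinAt_right (hx.intervalIntegrable_comp ha 0 t)
    (s := Ici t) (t := Ioi t)
    ⟨univ, univ_mem, (hx.measurable_comp ha).aestronglyMeasurable.restrict⟩
    ((hx.continuousWithinAt_comp ha t).mono Ioi_subset_Ici_self)).mono Ioi_subset_Ici_self

theorem IsCadlag.measurable_condDensity (hx : IsCadlag x) (ha : Continuous a) :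
    Measurable (condDensity a x) :=
  (hx.measurable_comp ha).mul (hx.continuous_cumIntensity ha).neg.rexp.measurable

theorem IsCadlag.intervalIntegrable_condDensity (hx : IsCadlag x) (ha : Continuous a) (s t : ℝ) :
    IntervalIntegrable (condDensity a x) volume s t :=
  (hx.intervalIntegrable_comp ha s t).mul_continuousOn
    (hx.continuous_cumIntensity ha).neg.rexp.continuousOn

theorem IsCadlag.integral_condDensity (hx : IsCadlag x) (ha : Continuous a) (t : ℝ) :
    ∫ s in (0 : ℝ)..t, condDensity a x s = 1 - Real.exp (-cumIntensity a x t) := by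
  have hc := hx.continuous_cumIntensity ha
  rw [intervalIntegral.integral_eq_sub_of_hasDeriv_right
    (f := fun s => -Real.exp (-cumIntensity a x s)) hc.neg.rexp.neg.continuousOn
    (fun s _ => ?_) (hx.intervalIntegrable_condDensity ha 0 t)]
  · simp [cumIntensity_zero]
    ring
  · have := (hx.hasDerivWithinAt_cumIntensity ha s).neg.exp.neg
    refine this.congr_deriv ?_
    simp [condDensity]
    ring

/-- By continuity the set defining the infimum is closed, hence the infimum is attained once the
level is reached. Quantifying over naturals keeps that condition countable. -/
theorem IsCadlag.eventTime_le_iff (hx : IsCadlag x) (ha : Continuous a) (ha0 : ∀ e, 0 ≤ a e)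
    {z t : ℝ} (ht : 0 ≤ t) (hz : ∃ n : ℕ, z ≤ cumIntensity a x n) :
    eventTime a x z ≤ t ↔ z ≤ cumIntensity a x t := by
  have hbdd : BddBelow {s : ℝ | 0 ≤ s ∧ z ≤ cumIntensity a x s} := ⟨0, fun _ hs => hs.1⟩
  refine ⟨fun h => ?_, fun h => csInf_le hbdd ⟨ht, h⟩⟩
  have hclosed : IsClosed {s : ℝ | 0 ≤ s ∧ z ≤ cumIntensity a x s} :=
    isClosed_Ici.inter (isClosed_le continuous_const (hx.continuous_cumIntensity ha))
  obtain ⟨n, hn⟩ := hz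
  exact (hclosed.csInf_mem ⟨n, n.cast_nonneg, hn⟩ hbdd).2.trans
    (hx.monotone_cumIntensity ha ha0 h)

theorem IsCadlag.eventTime_eq_zero (hx : IsCadlag x) (ha : Continuous a) (ha0 : ∀ e, 0 ≤ a e)
    {z : ℝ} (hz : ∀ n : ℕ, cumIntensity a x n < z) : eventTime a x z = 0 := by
  have : {s : ℝ | 0 ≤ s ∧ z ≤ cumIntensity a x s} = ∅ := by
    refine eq_empty_of_forall_notMem fun s hs => ?_
    obtain ⟨n, hn⟩ := exists_nat_ge s
    exact absurd (hs.2.trans (hx.monotone_cumIntensity ha ha0 hn)) (hz n).not_ge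
  rw [eventTime, this, Real.sInf_empty]

end Cadlag

/-! ### Measurability on path space -/

/-- The space of càdlàg paths, with the σ-algebra generated by the evaluations. -/
abbrev CadlagPath (E : Type*) [TopologicalSpace E] := {x : ℝ≥0 → E // IsCadlag x}

section CadlagPath

variable {E : Type*} [TopologicalSpace E] [MeasurableSpace E] [OpensMeasurableSpace E]
  {a : E → ℝ}

theorem measurable_cumIntensity (ha : Continuous a) (t : ℝ) :
    Measurable fun x : CadlagPath E => cumIntensity a x.1 t := by
  have h : Measurable (Function.uncurry fun (x : CadlagPath E) (s : ℝ) => a (x.1 s.toNNReal)) :=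
    measurable_uncurry_of_continuousWithinAt_Ici
      (fun s => ha.measurable.comp ((measurable_pi_apply _).comp measurable_subtype_coe))
      fun x r => x.2.continuousWithinAt_comp ha r
  simp only [cumIntensity, intervalIntegral]
  exact (h.stronglyMeasurable.integral_prod_right.sub
    h.stronglyMeasurable.integral_prod_right).measurable

theorem measurable_eventTime (ha : Continuous a) (ha0 : ∀ e, 0 ≤ a e) :
    Measurable fun p : CadlagPath E × ℝ => eventTime a p.1.1 p.2 := by
  have hA : ∀ t, Measurable fun p : CadlagPath E × ℝ => cumIntensity a p.1.1 t :=
    fun t => (measurable_cumIntensity ha t).comp measurable_fst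
  have hle : ∀ t, MeasurableSet {p : CadlagPath E × ℝ | p.2 ≤ cumIntensity a p.1.1 t} :=
    fun t => measurableSet_le measurable_snd (hA t)
  refine measurable_of_Iic fun t => ?_
  rcases lt_or_ge t 0 with ht | ht
  · convert MeasurableSet.empty
    refine eq_empty_of_forall_notMem fun p hp => ?_
    exact absurd (eventTime_nonneg a p.1.1 p.2) (not_le.2 (lt_of_le_of_lt hp ht))
  -- Where the level is never reached, `sInf ∅ = 0` puts the event time in `Iic t`; the complement
  -- accounts for this.
  · have : (fun p : CadlagPath E × ℝ => eventTime a p.1.1 p.2) ⁻¹' Iic t =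
        {p | p.2 ≤ cumIntensity a p.1.1 t} ∪
          (⋃ n : ℕ, {p : CadlagPath E × ℝ | p.2 ≤ cumIntensity a p.1.1 n})ᶜ := by
      ext p
      simp only [mem_preimage, mem_Iic, mem_union, mem_ofPred_eq, mem_compl_iff, mem_iUnion]
      by_cases h : ∃ n : ℕ, p.2 ≤ cumIntensity a p.1.1 n
      · rw [p.1.2.eventTime_le_iff ha ha0 ht h]
        tauto
      · refine iff_of_true ?_ (Or.inr h)
        rw [p.1.2.eventTime_eq_zero ha ha0 (by simpa using h)]
        exact ht
    rw [this]
    exact (hle t).union (MeasurableSet.iUnion fun n : ℕ => hle n).compl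

theorem measurable_eventTime_right (ha : Continuous a) (ha0 : ∀ e, 0 ≤ a e) (x : CadlagPath E) :
    Measurable (eventTime a x.1) :=
  (measurable_eventTime ha ha0).comp measurable_prodMk_left

end CadlagPath

/-! ### Law of an event time given the path -/

/-- The law of the event time along a fixed path when the trigger level is a unit exponential. -/
noncomputable def eventLaw {E : Type*} (a : E → ℝ) (x : ℝ≥0 → E) : Measure ℝ :=
  (expMeasure 1).map (eventTime a x)

theorem expMeasure_Iic {z : ℝ} (hz : 0 ≤ z) :
    expMeasure 1 (Iic z) = ENNReal.ofReal (1 - Real.exp (-z)) := by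
  have := isProbabilityMeasure_expMeasure one_pos
  rw [← ofReal_cdf, cdf_expMeasure_eq one_pos, if_pos hz, one_mul]

section EventLaw

variable {E : Type*} [TopologicalSpace E] [MeasurableSpace E] [OpensMeasurableSpace E]
  {a : E → ℝ}

theorem isProbabilityMeasure_eventLaw (ha : Continuous a) (ha0 : ∀ e, 0 ≤ a e)
    (x : CadlagPath E) : IsProbabilityMeasure (eventLaw a x.1) :=
  have := isProbabilityMeasure_expMeasure one_pos
  Measure.isProbabilityMeasure_map (measurable_eventTime_right ha ha0 x).aemeasurable

theorem eventLaw_Iic (ha : Continuous a) (ha0 : ∀ e, 0 ≤ a e) (x : CadlagPath E)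
    (hT : Tendsto (cumIntensity a x.1) atTop atTop) {t : ℝ} (ht : 0 ≤ t) :
    eventLaw a x.1 (Iic t) = ENNReal.ofReal (1 - Real.exp (-cumIntensity a x.1 t)) := by
  have h0 : 0 ≤ cumIntensity a x.1 t := by
    rw [← cumIntensity_zero (a := a) (x := x.1)]
    exact x.2.monotone_cumIntensity ha ha0 ht
  rw [eventLaw, Measure.map_apply (measurable_eventTime_right ha ha0 x) measurableSet_Iic,
    ← expMeasure_Iic h0]
  congr 1
  ext z
  have hz : ∃ n : ℕ, z ≤ cumIntensity a x.1 n :=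
    ((hT.comp tendsto_natCast_atTop_atTop).eventually_ge_atTop z).exists
  exact x.2.eventTime_le_iff ha ha0 ht hz

theorem eventLaw_eq_withDensity (ha : Continuous a) (ha0 : ∀ e, 0 ≤ a e) (x : CadlagPath E)
    (hT : Tendsto (cumIntensity a x.1) atTop atTop) :
    eventLaw a x.1 = (volume.restrict (Ioi 0)).withDensity
      fun s => ENNReal.ofReal (condDensity a x.1 s) := by
  have := isProbabilityMeasure_eventLaw ha ha0 x
  refine Measure.ext_of_Iic _ _ fun t => ?_
  rw [withDensity_apply _ measurableSet_Iic, Measure.restrict_restrict measurableSet_Iic,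
    inter_comm, Ioi_inter_Iic]
  rcases lt_or_ge t 0 with ht | ht
  · rw [Ioc_eq_empty (by simpa using ht.le), Measure.restrict_empty, lintegral_zero_measure,
      eventLaw, Measure.map_apply (measurable_eventTime_right ha ha0 x) measurableSet_Iic]
    convert measure_empty (μ := expMeasure 1)
    refine eq_empty_of_forall_notMem fun z hz => ?_
    exact absurd (eventTime_nonneg a x.1 z) (not_le.2 (lt_of_le_of_lt hz ht))
  · rw [eventLaw_Iic ha ha0 x hT ht, ← x.2.integral_condDensity ha,
      intervalIntegral.integral_of_le ht, ofReal_integral_eq_lintegral_ofReal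
        (x.2.intervalIntegrable_condDensity ha 0 t).1
        (ae_of_all _ fun s => condDensity_nonneg ha0 s)]

theorem eventLaw_Ici (ha : Continuous a) (ha0 : ∀ e, 0 ≤ a e) (x : CadlagPath E)
    (hT : Tendsto (cumIntensity a x.1) atTop atTop) {t : ℝ} (ht : 0 ≤ t) :
    (eventLaw a x.1).real (Ici t) = Real.exp (-cumIntensity a x.1 t) := by
  have := isProbabilityMeasure_eventLaw ha ha0 x
  -- Having a density, the law has no atoms, so closed and open tails agree.
  have hatoms : NullSingletonClass (eventLaw a x.1) := by
    rw [eventLaw_eq_withDensity ha ha0 x hT]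
    infer_instance
  have h0 : 0 ≤ cumIntensity a x.1 t := by
    rw [← cumIntensity_zero (a := a) (x := x.1)]
    exact x.2.monotone_cumIntensity ha ha0 ht
  have h1 : (eventLaw a x.1).real (Iic t) = 1 - Real.exp (-cumIntensity a x.1 t) := by
    rw [measureReal_def, eventLaw_Iic ha ha0 x hT ht, ENNReal.toReal_ofReal]
    simpa using h0
  rw [measureReal_congr Ioi_ae_eq_Ici.symm, ← compl_Iic, probReal_compl_eq_one_sub
    measurableSet_Iic, h1, sub_sub_cancel]

end EventLaw

/-! ### Spaced tuples and the iterated integral -/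

/-- Tuples `(h₀, …, hₙ, c)` whose truncations `min hₖ c` start at or after `y` and increase by at
least `ε` at each step. -/
def spacedSet (ε : ℝ) (n : ℕ) (y : ℝ) : Set (Fin (n + 2) → ℝ) :=
  {h | y ≤ min (h 0) (h (Fin.last _)) ∧ ∀ k : Fin n,
    min (h k.castSucc.castSucc) (h (Fin.last _)) + ε ≤ min (h k.succ.castSucc) (h (Fin.last _))}

/-- If `c < h 0`, the first truncation is already `c` and no later one can exceed it by `ε`. Hence
the first truncation is inactive, and the rest is the same condition on the tail: the recursion of
`orderedIntegral`. -/
theorem mem_spacedSet_succ {ε : ℝ} (hε : 0 < ε) {n : ℕ} {y : ℝ} {h : Fin (n + 3) → ℝ} :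
    h ∈ spacedSet ε (n + 1) y ↔ y ≤ h 0 ∧ (fun k : Fin (n + 2) => h k.succ) ∈
      spacedSet ε n (h 0 + ε) := by
  simp only [spacedSet, mem_ofPred_eq, Fin.forall_fin_succ (n := n), Fin.castSucc_zero,
    Fin.succ_last, ← Fin.succ_castSucc]
  constructor
  · rintro ⟨h1, h2, h3⟩
    have h4 : h 0 ≤ h (Fin.last (n + 2)) := by
      by_contra hc
      rw [min_eq_right (le_of_not_ge hc)] at h2
      exact absurd (h2.trans (min_le_right _ _)) (by simpa using hε)
    rw [min_eq_left h4] at h1 h2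
    exact ⟨h1, h2, h3⟩
  · rintro ⟨h1, h2, h3⟩
    have h4 : h 0 ≤ h (Fin.last (n + 2)) := by
      exact (le_add_of_nonneg_right hε.le).trans (h2.trans (min_le_right _ _))
    rw [min_eq_left h4]
    exact ⟨h1, h2, h3⟩

theorem measurableSet_spacedSet_prod (ε : ℝ) (n : ℕ) :
    MeasurableSet {p : ℝ × (Fin (n + 2) → ℝ) | p.2 ∈ spacedSet ε n p.1} := by
  have hm : ∀ k, Measurable fun p : ℝ × (Fin (n + 2) → ℝ) => p.2 k :=
    fun k => (measurable_pi_apply k).comp measurable_snd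
  have heq : {p : ℝ × (Fin (n + 2) → ℝ) | p.2 ∈ spacedSet ε n p.1} =
      {p | p.1 ≤ min (p.2 0) (p.2 (Fin.last _))} ∩
        ⋂ k : Fin n, {p | min (p.2 k.castSucc.castSucc) (p.2 (Fin.last _)) + ε ≤
          min (p.2 k.succ.castSucc) (p.2 (Fin.last _))} := by
    ext p
    simp only [spacedSet, mem_ofPred_eq, mem_inter_iff, mem_iInter]
  rw [heq]
  exact (measurableSet_le measurable_fst ((hm _).min (hm _))).inter <|
    MeasurableSet.iInter fun k =>
      measurableSet_le (((hm _).min (hm _)).add_const ε) ((hm _).min (hm _))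

theorem measurableSet_spacedSet (ε : ℝ) (n : ℕ) (y : ℝ) : MeasurableSet (spacedSet ε n y) :=
  (measurableSet_spacedSet_prod ε n).preimage measurable_prodMk_left

theorem pairIntegral_eq_orderedIntegral {E : Type*} (a b c : E → ℝ) (ε : ℝ) (x : ℝ≥0 → E) :
    pairIntegral a b c ε x = orderedIntegral c ε x [a, b] 0 := by
  simp only [pairIntegral, orderedIntegral, condDensity]
  congr 1
  ext s
  rw [mul_assoc, ← Real.exp_add]
  congr 2
  ring

section OrderedIntegral

variable {E : Type*} [TopologicalSpace E] [MeasurableSpace E] [OpensMeasurableSpace E]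

/-- Induction by Fubini on the first coordinate. In the base case one bank and the stress event must
both occur at or after `y`, a product of two tails. -/
theorem pi_eventLaw_spacedSet {ε : ℝ} (hε : 0 < ε) (x : CadlagPath E) :
    ∀ (n : ℕ) (a : Fin (n + 2) → E → ℝ) (_ : ∀ k, Continuous (a k)) (_ : ∀ k e, 0 ≤ a k e)
      (_ : ∀ k, Tendsto (cumIntensity (a k) x.1) atTop atTop) (y : ℝ) (_ : 0 ≤ y),
      (Measure.pi fun k => eventLaw (a k) x.1).real (spacedSet ε n y) =
        orderedIntegral (a (Fin.last _)) ε x.1 (List.ofFn fun k : Fin (n + 1) => a k.castSucc) y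
  | 0, a, ha, ha0, hT, y, hy => by
    have hp := fun k => isProbabilityMeasure_eventLaw (ha k) (ha0 k) x
    have : spacedSet ε 0 y = univ.pi fun _ => Ici y := by
      ext h
      simp [spacedSet, Pi.le_def, Fin.forall_fin_two]
    rw [this, measureReal_def, Measure.pi_pi, ENNReal.toReal_prod, Fin.prod_univ_two]
    simp only [← measureReal_def, eventLaw_Ici (ha _) (ha0 _) x (hT _) hy]
    rw [← Real.exp_add, ← sub_eq_add_neg]
    rfl
  | n + 1, a, ha, ha0, hT, y, hy => by
    have hp := fun k => isProbabilityMeasure_eventLaw (ha k) (ha0 k) x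
    have ih := fun y' => pi_eventLaw_spacedSet hε x n (fun k => a k.succ) (fun k => ha _)
      (fun k => ha0 _) (fun k => hT _) y'
    set M : Measure (Fin (n + 2) → ℝ) := Measure.pi fun k => eventLaw (a k.succ) x.1 with hM
    have hmeas : Measurable fun s => M (spacedSet ε n (s + ε)) :=
      (measurable_measure_prodMk_left (ν := M) (measurableSet_spacedSet_prod ε n)).comp
        (measurable_id.add_const ε)
    have hfm : Measurable fun s => ENNReal.ofReal (condDensity (a 0) x.1 s) :=
      (x.2.measurable_condDensity (ha 0)).ennreal_ofReal
    have hset : MeasurableSet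
        {p : ℝ × (Fin (n + 2) → ℝ) | y ≤ p.1 ∧ p.2 ∈ spacedSet ε n (p.1 + ε)} :=
      (measurableSet_le measurable_const measurable_fst).inter
        ((measurableSet_spacedSet_prod ε n).preimage
          ((measurable_fst.add_const ε).prodMk measurable_snd))
    have hprod : (Measure.pi fun k => eventLaw (a k) x.1) (spacedSet ε (n + 1) y) =
        ((eventLaw (a 0) x.1).prod M) {p | y ≤ p.1 ∧ p.2 ∈ spacedSet ε n (p.1 + ε)} := by
      have := measurePreserving_piFinSuccAbove (fun k => eventLaw (a k) x.1) 0
      simp only [Fin.succAbove_zero] at this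
      rw [← this.measure_preimage hset.nullMeasurableSet]
      congr 1
      ext h
      exact mem_spacedSet_succ hε
    have hlint : (Measure.pi fun k => eventLaw (a k) x.1) (spacedSet ε (n + 1) y) =
        ∫⁻ s in Ioi y, ENNReal.ofReal (condDensity (a 0) x.1 s) * M (spacedSet ε n (s + ε)) := by
      rw [hprod, Measure.prod_apply hset]
      have hind : ∀ s, M (Prod.mk s ⁻¹' {p | y ≤ p.1 ∧ p.2 ∈ spacedSet ε n (p.1 + ε)}) =
          (Ici y).indicator (fun s => M (spacedSet ε n (s + ε))) s := by
        intro s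
        by_cases hs : y ≤ s
        · simp [indicator, hs]
        · simp [indicator, hs]
      simp_rw [hind]
      rw [lintegral_indicator measurableSet_Ici, eventLaw_eq_withDensity (ha 0) (ha0 0) x (hT 0),
        setLIntegral_withDensity_eq_setLIntegral_mul _ hfm hmeas measurableSet_Ici,
        Measure.restrict_restrict measurableSet_Ici]
      -- As `0 ≤ y`, restricting to `Ioi 0` costs at most the endpoint.
      have hae : (Ici y ∩ Ioi 0 : Set ℝ) =ᵐ[volume] Ioi y := by
        have : (Ioi y ∩ Ioi 0 : Set ℝ) = Ioi y :=
          inter_eq_left.2 fun s hs => lt_of_le_of_lt hy hs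
        exact this ▸ Ioi_ae_eq_Ici.symm.inter (ae_eq_refl _)
      rw [Measure.restrict_congr_set hae]
      rfl
    rw [measureReal_def, hlint, ← integral_toReal
      (f := fun s => ENNReal.ofReal (condDensity (a 0) x.1 s) * M (spacedSet ε n (s + ε)))
      (hfm.mul hmeas).aemeasurable
      (ae_of_all _ fun s => ENNReal.mul_lt_top ENNReal.ofReal_lt_top (measure_lt_top _ _)),
      List.ofFn_succ, List.ofFn_succ, orderedIntegral]
    refine setIntegral_congr_fun measurableSet_Ioi fun s hs => ?_
    have hs' : 0 ≤ s + ε := by linarith [mem_Ioi.1 hs]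
    simp only [ENNReal.toReal_mul, ENNReal.toReal_ofReal (condDensity_nonneg (ha0 0) s)]
    rw [← measureReal_def, ih _ hs', List.ofFn_succ]
    rfl

end OrderedIntegral

/-! ### Averaging over the path -/

theorem measurable_cadlagPath_mk {E : Type*} [TopologicalSpace E] [MeasurableSpace E]
    {Ω : Type*} [MeasurableSpace Ω] {X : ℝ≥0 → Ω → E} (hX : ∀ t, Measurable (X t))
    (hXpath : ∀ ω, IsCadlag fun t => X t ω) :
    Measurable fun ω => (⟨fun t => X t ω, hXpath ω⟩ : CadlagPath E) :=
  (measurable_pi_lambda _ hX).subtype_mk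

theorem map_cadlagPath_prodMk {E : Type*} [TopologicalSpace E] [MeasurableSpace E]
    {Ω : Type*} [MeasurableSpace Ω] {X : ℝ≥0 → Ω → E} {ι : Type*} [Fintype ι] {P : Measure Ω}
    [IsProbabilityMeasure P] {Z : ι → Ω → ℝ} (hX : ∀ t, Measurable (X t))
    (hXpath : ∀ ω, IsCadlag fun t => X t ω) (hZ : ∀ k, Measurable (Z k))
    (hZlaw : ∀ k, P.map (Z k) = expMeasure 1) (hZindep : iIndepFun Z P)
    (hXZ : IndepFun (fun ω (t : ℝ≥0) => X t ω) (fun ω k => Z k ω) P) :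
    P.map (fun ω => ((⟨fun t => X t ω, hXpath ω⟩ : CadlagPath E), fun k => Z k ω)) =
      (P.map fun ω => (⟨fun t => X t ω, hXpath ω⟩ : CadlagPath E)).prod
        (Measure.pi fun _ => expMeasure 1) := by
  have hVm : Measurable fun ω k => Z k ω := measurable_pi_lambda _ hZ
  have hind : IndepFun (fun ω => (⟨fun t => X t ω, hXpath ω⟩ : CadlagPath E))
      (fun ω k => Z k ω) P := by
    -- Path space carries the σ-algebra pulled back from the product space, so both forms of the
    -- process generate the same σ-algebra on `Ω`.
    rw [IndepFun_iff_Indep] at hXZ ⊢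
    convert hXZ using 1
    exact MeasurableSpace.comap_comp
  rw [hind.map_prod_eq_prod_map_map (measurable_cadlagPath_mk hX hXpath).aemeasurable
    hVm.aemeasurable, (iIndepFun_iff_map_fun_eq_pi_map fun k => (hZ k).aemeasurable).1 hZindep]
  simp only [hZlaw]

section Averaging

variable {E : Type*} [TopologicalSpace E] [MeasurableSpace E] [OpensMeasurableSpace E]
  {Ω : Type*} [MeasurableSpace Ω] {X : ℝ≥0 → Ω → E}

variable {ι : Type*} [Fintype ι] {a : ι → E → ℝ}

theorem pi_expMeasure_preimage (ha : ∀ k, Continuous (a k)) (ha0 : ∀ k e, 0 ≤ a k e)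
    (x : CadlagPath E) {B : Set (ι → ℝ)} (hB : MeasurableSet B) :
    (Measure.pi fun _ : ι => expMeasure 1) {z | (fun k => eventTime (a k) x.1 (z k)) ∈ B} =
      (Measure.pi fun k => eventLaw (a k) x.1) B := by
  have hm := fun k => measurable_eventTime_right (ha k) (ha0 k) x
  have hp := isProbabilityMeasure_expMeasure one_pos
  have hp' : ∀ k, IsProbabilityMeasure ((expMeasure 1).map (eventTime (a k) x.1)) :=
    fun k => isProbabilityMeasure_eventLaw (ha k) (ha0 k) x
  simp only [eventLaw]
  rw [← Measure.pi_map_pi fun k => (hm k).aemeasurable, Measure.map_apply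
    (f := fun (z : ι → ℝ) k => eventTime (a k) x.1 (z k))
    (measurable_pi_lambda _ fun k => (hm k).comp (measurable_pi_apply k)) hB]
  rfl

variable {P : Measure Ω} [IsProbabilityMeasure P] {Z : ι → Ω → ℝ}

theorem measurableSet_eventTime_mem {ι : Type*} {a : ι → E → ℝ} (ha : ∀ k, Continuous (a k)) (ha0 : ∀ k e, 0 ≤ a k e)
    {B : Set (ι → ℝ)} (hB : MeasurableSet B) :
    MeasurableSet {q : CadlagPath E × (ι → ℝ) | (fun k => eventTime (a k) q.1.1 (q.2 k)) ∈ B} := by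
  refine hB.preimage (measurable_pi_lambda _ fun k => ?_)
  exact (measurable_eventTime (ha k) (ha0 k)).comp
    (measurable_fst.prodMk ((measurable_pi_apply k).comp measurable_snd))

/-- Rewritten with the trigger levels, the path-dependent law becomes a section of one measurable
set under a fixed measure. -/
theorem measurable_pi_eventLaw (ha : ∀ k, Continuous (a k)) (ha0 : ∀ k e, 0 ≤ a k e)
    {B : Set (ι → ℝ)} (hB : MeasurableSet B) :
    Measurable fun x : CadlagPath E => (Measure.pi fun k => eventLaw (a k) x.1) B := by
  have hp := isProbabilityMeasure_expMeasure one_pos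
  simp only [← pi_expMeasure_preimage ha ha0 _ hB]
  exact measurable_measure_prodMk_left (measurableSet_eventTime_mem ha ha0 hB)

/-- Conditionally on the path, the event times are independent with laws `eventLaw`. -/
theorem measureReal_eventTime_mem (hX : ∀ t, Measurable (X t))
    (hXpath : ∀ ω, IsCadlag fun t => X t ω) (hZ : ∀ k, Measurable (Z k))
    (hZlaw : ∀ k, P.map (Z k) = expMeasure 1) (hZindep : iIndepFun Z P)
    (hXZ : IndepFun (fun ω (t : ℝ≥0) => X t ω) (fun ω k => Z k ω) P)
    (ha : ∀ k, Continuous (a k)) (ha0 : ∀ k e, 0 ≤ a k e)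
    {B : Set (ι → ℝ)} (hB : MeasurableSet B) :
    Integrable (fun ω => (Measure.pi fun k => eventLaw (a k) fun t => X t ω).real B) P ∧
    P.real {ω | (fun k => eventTime (a k) (fun t => X t ω) (Z k ω)) ∈ B} =
      ∫ ω, (Measure.pi fun k => eventLaw (a k) fun t => X t ω).real B ∂P := by
  have hp := isProbabilityMeasure_expMeasure one_pos
  have hUm := measurable_cadlagPath_mk hX hXpath
  have hVm : Measurable fun ω k => Z k ω := measurable_pi_lambda _ hZ
  have hG := measurable_pi_eventLaw ha ha0 hB
  have hprob : ∀ ω, IsProbabilityMeasure (Measure.pi fun k => eventLaw (a k) fun t => X t ω) := by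
    intro ω
    have : ∀ k, IsProbabilityMeasure (eventLaw (a k) fun t => X t ω) :=
      fun k => isProbabilityMeasure_eventLaw (ha k) (ha0 k) ⟨fun t => X t ω, hXpath ω⟩
    infer_instance
  have hGU : Measurable fun ω => (Measure.pi fun k => eventLaw (a k) fun t => X t ω) B := by
    have h1 := hG.comp hUm
    simp only [Function.comp_def] at h1
    exact h1
  have hmain : P {ω | (fun k => eventTime (a k) (fun t => X t ω) (Z k ω)) ∈ B} =
      ∫⁻ ω, (Measure.pi fun k => eventLaw (a k) fun t => X t ω) B ∂P := by
    have h1 := Measure.map_apply (μ := P) (hUm.prodMk hVm) (measurableSet_eventTime_mem ha ha0 hB)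
    rw [map_cadlagPath_prodMk hX hXpath hZ hZlaw hZindep hXZ,
      Measure.prod_apply (measurableSet_eventTime_mem ha ha0 hB)] at h1
    refine h1.symm.trans ?_
    rw [← lintegral_map (μ := P) hG hUm]
    exact lintegral_congr fun x => pi_expMeasure_preimage ha ha0 x hB
  refine ⟨Integrable.of_bound hGU.ennreal_toReal.aestronglyMeasurable 1
    (ae_of_all _ fun ω => ?_), ?_⟩
  · rw [Real.norm_of_nonneg measureReal_nonneg]
    exact measureReal_le_one
  · simp only [measureReal_def]
    rw [integral_toReal hGU.aemeasurable (ae_of_all _ fun ω => measure_lt_top _ _), hmain]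

end Averaging

/-! ### Spaced default events and their probabilities -/

section Market

variable {E : Type*} [TopologicalSpace E] [MeasurableSpace E] [OpensMeasurableSpace E]
  {Ω : Type*} [MeasurableSpace Ω] {K : ℕ}
  {X : ℝ≥0 → Ω → E} {Z : Fin (K + 1) → Ω → ℝ} {α : Fin (K + 1) → E → ℝ}

theorem defaultTime_nonneg {E Ω : Type*} {K : ℕ} (α : Fin (K + 1) → E → ℝ) (X : ℝ≥0 → Ω → E)
    (Z : Fin (K + 1) → Ω → ℝ) (i : Fin K) (ω : Ω) : 0 ≤ defaultTime α X Z i ω :=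
  le_min (eventTime_nonneg _ _ _) (eventTime_nonneg _ _ _)

/-- The standing assumptions: a càdlàg state process, independent unit exponential triggers that
are independent of it, and continuous nonnegative intensities with divergent integrals. -/
structure IsMarket (P : Measure Ω) (X : ℝ≥0 → Ω → E) (Z : Fin (K + 1) → Ω → ℝ)
    (α : Fin (K + 1) → E → ℝ) : Prop where
  measurable_state : ∀ t, Measurable (X t)
  cadlag : ∀ ω, IsCadlag fun t => X t ω
  measurable_trigger : ∀ k, Measurable (Z k)
  law_trigger : ∀ k, P.map (Z k) = expMeasure 1
  iIndep_trigger : iIndepFun Z P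
  indep : IndepFun (fun ω (t : ℝ≥0) => X t ω) (fun ω (k : Fin (K + 1)) => Z k ω) P
  continuous : ∀ k, Continuous (α k)
  nonneg : ∀ k x, 0 ≤ α k x
  tendsto : ∀ k, ∀ᵐ ω ∂P, Tendsto (cumIntensity (α k) fun t => X t ω) atTop atTop

variable {P : Measure Ω}

theorem IsMarket.measurable_defaultTime (h : IsMarket P X Z α) (i : Fin K) :
    Measurable (defaultTime α X Z i) := by
  have hm : ∀ k, Measurable fun ω => eventTime (α k) (fun t => X t ω) (Z k ω) := fun k =>
    (measurable_eventTime (h.continuous k) (h.nonneg k)).comp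
      ((measurable_cadlagPath_mk h.measurable_state h.cadlag).prodMk (h.measurable_trigger k))
  exact (hm 0).min (hm i.succ)

/-- The banks `e 0, e 1, …` default in this order, with gaps of at least `ε`. -/
def spacedEvent {E Ω : Type*} {K : ℕ} (α : Fin (K + 1) → E → ℝ) (X : ℝ≥0 → Ω → E)
    (Z : Fin (K + 1) → Ω → ℝ) (ε : ℝ) {n : ℕ} (e : Fin (n + 1) → Fin K) : Set Ω :=
  {ω | ∀ k : Fin n, defaultTime α X Z (e k.castSucc) ω + ε ≤ defaultTime α X Z (e k.succ) ω}

theorem IsMarket.measurableSet_spacedEvent (h : IsMarket P X Z α) (ε : ℝ) {n : ℕ}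
    (e : Fin (n + 1) → Fin K) : MeasurableSet (spacedEvent α X Z ε e) := by
  have hm := h.measurable_defaultTime
  have : spacedEvent α X Z ε e = ⋂ k : Fin n,
      {ω | defaultTime α X Z (e k.castSucc) ω + ε ≤ defaultTime α X Z (e k.succ) ω} := by
    ext ω
    simp only [spacedEvent, mem_ofPred_eq, mem_iInter]
  rw [this]
  exact MeasurableSet.iInter fun k => measurableSet_le ((hm _).add_const ε) (hm _)

/-- The indices of the banks `e 0, e 1, …`, followed by that of the stress event. -/
def stressLast {K n : ℕ} (e : Fin (n + 1) → Fin K) : Fin (n + 2) → Fin (K + 1) :=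
  Fin.snoc (α := fun _ => Fin (K + 1)) (fun k => (e k).succ) 0

@[simp]
theorem stressLast_castSucc {K n : ℕ} (e : Fin (n + 1) → Fin K) (k : Fin (n + 1)) :
    stressLast e k.castSucc = (e k).succ := by
  simp [stressLast]

@[simp]
theorem stressLast_last {K n : ℕ} (e : Fin (n + 1) → Fin K) :
    stressLast e (Fin.last (n + 1)) = 0 := by
  simp [stressLast]

theorem stressLast_injective {K n : ℕ} {e : Fin (n + 1) → Fin K} (he : Function.Injective e) :
    Function.Injective (stressLast e) := by
  intro k l
  induction k using Fin.lastCases <;> induction l using Fin.lastCases <;>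
    simp [Fin.succ_ne_zero, (Fin.succ_ne_zero _).symm, he.eq_iff]

/-- The starting bound `0` costs nothing because default times are nonnegative. -/
theorem mem_spacedEvent_iff {E Ω : Type*} {K : ℕ} {α : Fin (K + 1) → E → ℝ} {X : ℝ≥0 → Ω → E}
    {Z : Fin (K + 1) → Ω → ℝ} {ε : ℝ} {n : ℕ} {e : Fin (n + 1) → Fin K} {ω : Ω} :
    ω ∈ spacedEvent α X Z ε e ↔ (fun k => eventTime (α (stressLast e k)) (fun t => X t ω)
      (Z (stressLast e k) ω)) ∈ spacedSet ε n 0 := by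
  have h0 : (0 : Fin (n + 2)) = (0 : Fin (n + 1)).castSucc := rfl
  have h1 := defaultTime_nonneg α X Z (e 0) ω
  rw [defaultTime, min_comm] at h1
  simp only [spacedEvent, spacedSet, mem_ofPred_eq, h0, stressLast_castSucc, stressLast_last,
    defaultTime, h1, true_and, min_comm (eventTime (α 0) _ _)]

theorem le_of_mem_spacedEvent {E Ω : Type*} {K : ℕ} {α : Fin (K + 1) → E → ℝ}
    {X : ℝ≥0 → Ω → E} {Z : Fin (K + 1) → Ω → ℝ} {ε : ℝ} {n : ℕ} {e : Fin (n + 1) → Fin K} {ω : Ω}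
    (h : ω ∈ spacedEvent α X Z ε e) (k : Fin (n + 1)) :
    k.val * ε ≤ defaultTime α X Z (e k) ω := by
  induction k using Fin.induction with
  | zero => simpa using defaultTime_nonneg α X Z (e 0) ω
  | succ k ih =>
    have := h k
    simp only [Fin.val_castSucc, Fin.val_succ] at ih ⊢
    push_cast
    linarith

variable [IsProbabilityMeasure P] {ε : ℝ} {n : ℕ} {e : Fin (n + 1) → Fin K}

theorem IsMarket.measureReal_eventTime_stressLast_mem (h : IsMarket P X Z α)
    (he : Function.Injective e)
    {B : Set (Fin (n + 2) → ℝ)} (hB : MeasurableSet B) :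
    Integrable (fun ω =>
      (Measure.pi fun k => eventLaw (α (stressLast e k)) fun t => X t ω).real B) P ∧
    P.real {ω | (fun k => eventTime (α (stressLast e k)) (fun t => X t ω)
        (Z (stressLast e k) ω)) ∈ B} =
      ∫ ω, (Measure.pi fun k => eventLaw (α (stressLast e k)) fun t => X t ω).real B ∂P :=
  measureReal_eventTime_mem (Z := fun k => Z (stressLast e k)) (a := fun k => α (stressLast e k))
    h.measurable_state h.cadlag (fun _ => h.measurable_trigger _) (fun _ => h.law_trigger _)
    (h.iIndep_trigger.precomp (stressLast_injective he))
    (h.indep.comp (ψ := fun (z : Fin (K + 1) → ℝ) k => z (stressLast e k)) measurable_id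
      (measurable_pi_lambda _ fun _ => measurable_pi_apply _))
    (fun _ => h.continuous _) (fun _ => h.nonneg _) hB

theorem IsMarket.measureReal_spacedEvent (h : IsMarket P X Z α) (hε : 0 < ε)
    (he : Function.Injective e) :
    Integrable (fun ω => orderedIntegral (α 0) ε (fun t => X t ω)
      (List.ofFn fun k => α (e k).succ) 0) P ∧
    P.real (spacedEvent α X Z ε e) = ∫ ω, orderedIntegral (α 0) ε (fun t => X t ω)
      (List.ofFn fun k => α (e k).succ) 0 ∂P := by
  obtain ⟨h1, h2⟩ := h.measureReal_eventTime_stressLast_mem he (measurableSet_spacedSet ε n 0)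
  have hae : (fun ω => (Measure.pi fun k => eventLaw (α (stressLast e k)) fun t => X t ω).real
      (spacedSet ε n 0)) =ᵐ[P] fun ω => orderedIntegral (α 0) ε (fun t => X t ω)
      (List.ofFn fun k => α (e k).succ) 0 := by
    filter_upwards [ae_all_iff.2 h.tendsto] with ω hω
    have := pi_eventLaw_spacedSet hε ⟨fun t => X t ω, h.cadlag ω⟩ n (fun k => α (stressLast e k))
      (fun _ => h.continuous _) (fun _ => h.nonneg _) (fun _ => hω _) 0 le_rfl
    simpa only [stressLast_castSucc, stressLast_last] using this
  refine ⟨h1.congr hae, ?_⟩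
  rw [← integral_congr_ae hae, ← h2]
  congr 1
  ext ω
  exact mem_spacedEvent_iff

/-- The event lies in a box of event times, whose conditional probability is a product of tails. -/
theorem IsMarket.measureReal_spacedEvent_le (h : IsMarket P X Z α) (hε : 0 < ε)
    (he : Function.Injective e) :
    Integrable (fun ω => Real.exp (-cumIntensity (α 0) (fun t => X t ω) (n * ε)) *
      Real.exp (-∑ k : Fin (n + 1) with 0 < k.val,
        cumIntensity (α (e k).succ) (fun t => X t ω) (k.val * ε))) P ∧
    P.real (spacedEvent α X Z ε e) ≤
      ∫ ω, Real.exp (-cumIntensity (α 0) (fun t => X t ω) (n * ε)) *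
        Real.exp (-∑ k : Fin (n + 1) with 0 < k.val,
          cumIntensity (α (e k).succ) (fun t => X t ω) (k.val * ε)) ∂P := by
  set T : Fin (n + 2) → ℝ := Fin.snoc (α := fun _ => ℝ) (fun k : Fin (n + 1) => k.val * ε) (n * ε)
    with hT
  have hTc : ∀ k : Fin (n + 1), T k.castSucc = k.val * ε := fun k => by simp [hT]
  have hTl : T (Fin.last _) = n * ε := by simp [hT]
  have hT0 : ∀ k, 0 ≤ T k := by
    intro k
    induction k using Fin.lastCases with
    | last => rw [hTl]; positivity
    | cast k => rw [hTc]; positivity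
  have hB : MeasurableSet (univ.pi fun k => Ici (T k)) :=
    MeasurableSet.univ_pi fun _ => measurableSet_Ici
  obtain ⟨h1, h2⟩ := h.measureReal_eventTime_stressLast_mem he hB
  have hae : (fun ω => (Measure.pi fun k => eventLaw (α (stressLast e k)) fun t => X t ω).real
      (univ.pi fun k => Ici (T k))) =ᵐ[P] fun ω =>
        Real.exp (-cumIntensity (α 0) (fun t => X t ω) (n * ε)) *
        Real.exp (-∑ k : Fin (n + 1) with 0 < k.val,
          cumIntensity (α (e k).succ) (fun t => X t ω) (k.val * ε)) := by
    filter_upwards [ae_all_iff.2 h.tendsto] with ω hω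
    let x : CadlagPath E := ⟨fun t => X t ω, h.cadlag ω⟩
    have hp := fun k => isProbabilityMeasure_eventLaw (h.continuous k) (h.nonneg k) x
    change (Measure.pi fun k => eventLaw (α (stressLast e k)) x.1).real _ = _
    rw [measureReal_def, Measure.pi_pi, ENNReal.toReal_prod]
    have hlaw : ∀ k, (eventLaw (α (stressLast e k)) x.1 (Ici (T k))).toReal =
        Real.exp (-cumIntensity (α (stressLast e k)) x.1 (T k)) :=
      fun k => eventLaw_Ici (h.continuous _) (h.nonneg _) x (hω _) (hT0 k)
    simp_rw [hlaw]
    rw [Fin.prod_univ_castSucc, mul_comm, ← Real.exp_sum]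
    simp only [hTc, hTl, stressLast_castSucc, stressLast_last]
    congr 2
    rw [Finset.sum_neg_distrib, Finset.sum_filter]
    congr 1
    refine Finset.sum_congr rfl fun k _ => ?_
    split_ifs with hk
    · rfl
    -- The first bank has threshold `0`, where the cumulative intensity vanishes; hence its absence
    -- from the sum.
    · have : k.val = 0 := by omega
      simp [this, cumIntensity_zero]
  refine ⟨h1.congr hae, ?_⟩
  rw [← integral_congr_ae hae, ← h2]
  refine measureReal_mono fun ω hω => ?_
  simp only [mem_ofPred_eq, mem_univ_pi, mem_Ici]
  have hle := le_of_mem_spacedEvent hω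
  intro k
  induction k using Fin.lastCases with
  | last =>
    rw [hTl, stressLast_last]
    -- The stress time is at least the last default time.
    have hlast := (hle (Fin.last n)).trans (min_le_left _ _)
    simpa using hlast
  | cast k =>
    rw [hTc, stressLast_castSucc]
    exact (hle k).trans (min_le_right _ _)

theorem compl_failureEvent_iff {E Ω : Type*} {K : ℕ} {α : Fin (K + 1) → E → ℝ}
    {X : ℝ≥0 → Ω → E} {Z : Fin (K + 1) → Ω → ℝ} {ε : ℝ} {ω : Ω} :
    ω ∈ (failureEvent α X Z ε)ᶜ ↔ ∀ i j, i ≠ j →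
      ε ≤ |defaultTime α X Z i ω - defaultTime α X Z j ω| := by
  simp [failureEvent]

end Market

/-! ### Counting pairs and comparing two banks -/

theorem sum_sum_ne_eq_sum_sum_lt {K : ℕ} (q : Fin K → Fin K → ℝ) :
    ∑ i, ∑ j with j ≠ i, q i j = ∑ i, ∑ j with i < j, (q i j + q j i) := by
  simp only [Finset.sum_filter]
  have h : ∀ i j : Fin K, (if j ≠ i then q i j else 0) =
      (if i < j then q i j else 0) + (if j < i then q i j else 0) := by
    intro i j
    rcases lt_trichotomy i j with h | h | h
    · simp [h, h.ne', h.not_gt]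
    · simp [h]
    · simp [h, h.ne, h.not_gt]
  simp only [h, Finset.sum_add_distrib, ite_add_zero]
  congr 1
  exact Finset.sum_comm

theorem choose_two_sub_sum_sum_ne {K : ℕ} (q : Fin K → Fin K → ℝ) :
    (K.choose 2 : ℝ) - ∑ i, ∑ j with j ≠ i, q i j =
      ∑ i, ∑ j with i < j, (1 - (q i j + q j i)) := by
  -- Each ordered pair gets weight `1 / 2`, so symmetrizing gives weight `1` to each `i < j`.
  have hK : (K.choose 2 : ℝ) = ∑ i : Fin K, ∑ j : Fin K with j ≠ i, (1 / 2 : ℝ) := by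
    simp [Finset.filter_ne', Nat.cast_choose_two]
    rcases K with _ | K
    · simp
    · simp
      ring
  rw [hK, sum_sum_ne_eq_sum_sum_lt, sum_sum_ne_eq_sum_sum_lt]
  simp only [← Finset.sum_sub_distrib]
  norm_num

section Market

variable {E : Type*} {Ω : Type*} {K : ℕ} {X : ℝ≥0 → Ω → E} {Z : Fin (K + 1) → Ω → ℝ}
  {α : Fin (K + 1) → E → ℝ} {ε : ℝ} {n : ℕ} {ω : Ω}

theorem strictMono_of_mem_spacedEvent (hε : 0 < ε) {e : Fin (n + 1) → Fin K}
    (h : ω ∈ spacedEvent α X Z ε e) : StrictMono fun k => defaultTime α X Z (e k) ω :=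
  Fin.strictMono_iff_lt_succ.2 fun k => (lt_add_of_pos_right _ hε).trans_le (h k)

theorem add_le_of_mem_spacedEvent (hε : 0 < ε) {e : Fin (n + 1) → Fin K}
    (h : ω ∈ spacedEvent α X Z ε e) {k l : Fin (n + 1)} (hkl : k < l) :
    defaultTime α X Z (e k) ω + ε ≤ defaultTime α X Z (e l) ω := by
  obtain ⟨k, rfl⟩ := Fin.exists_castSucc_eq.2 (Fin.ne_last_of_lt hkl)
  exact (h k).trans <| (strictMono_of_mem_spacedEvent hε h).monotone
    (Fin.castSucc_lt_iff_succ_le.1 hkl)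

theorem mem_spacedEvent_pair {i j : Fin K} : ω ∈ spacedEvent α X Z ε ![i, j] ↔
    defaultTime α X Z i ω + ε ≤ defaultTime α X Z j ω := by
  simp [spacedEvent]

theorem injective_pair {i j : Fin K} (hij : i ≠ j) : Function.Injective ![i, j] := by
  intro k l
  fin_cases k <;> fin_cases l <;> simp [hij, hij.symm]

theorem le_abs_sub_defaultTime_iff {i j : Fin K} :
    ε ≤ |defaultTime α X Z i ω - defaultTime α X Z j ω| ↔
      ω ∈ spacedEvent α X Z ε ![i, j] ∪ spacedEvent α X Z ε ![j, i] := by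
  rw [mem_union, mem_spacedEvent_pair, mem_spacedEvent_pair, le_abs', or_comm]
  constructor <;> rintro (h | h) <;> first | (left; linarith) | (right; linarith)

theorem disjoint_spacedEvent_pair (hε : 0 < ε) (i j : Fin K) :
    Disjoint (spacedEvent α X Z ε ![i, j]) (spacedEvent α X Z ε ![j, i]) := by
  refine Set.disjoint_left.2 fun ω h1 h2 => ?_
  rw [mem_spacedEvent_pair] at h1 h2
  linarith

end Market

/-! ### Decomposition of non-failure by default order -/

section Perm

variable {E : Type*} {Ω : Type*} {X : ℝ≥0 → Ω → E} {n : ℕ} {Z : Fin (n + 2) → Ω → ℝ}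
  {α : Fin (n + 2) → E → ℝ} {ε : ℝ}

theorem spacedEvent_perm_subset (hε : 0 < ε) (σ : Equiv.Perm (Fin (n + 1))) :
    spacedEvent α X Z ε σ ⊆ (failureEvent α X Z ε)ᶜ := by
  intro ω h
  rw [compl_failureEvent_iff]
  intro i j hij
  obtain ⟨k, rfl⟩ := σ.surjective i
  obtain ⟨l, rfl⟩ := σ.surjective j
  rcases lt_or_gt_of_ne (fun hkl => hij (congrArg σ hkl)) with hkl | hkl
  · rw [abs_sub_comm]
    exact (le_sub_iff_add_le'.2 (add_le_of_mem_spacedEvent hε h hkl)).trans (le_abs_self _)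
  · exact (le_sub_iff_add_le'.2 (add_le_of_mem_spacedEvent hε h hkl)).trans (le_abs_self _)

/-- A set of reals has at most one strictly increasing enumeration by `Fin (n + 1)`. -/
theorem disjoint_spacedEvent_perm (hε : 0 < ε) {σ σ' : Equiv.Perm (Fin (n + 1))} (h : σ ≠ σ') :
    Disjoint (spacedEvent α X Z ε σ) (spacedEvent α X Z ε σ') := by
  refine Set.disjoint_left.2 fun ω h1 h2 => h ?_
  have m1 := strictMono_of_mem_spacedEvent hε h1
  have m2 := strictMono_of_mem_spacedEvent hε h2
  set τ : Fin (n + 1) → ℝ := fun i => defaultTime α X Z i ω with hτ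
  have hr : ∀ σ : Equiv.Perm (Fin (n + 1)), range (fun k => τ (σ k)) = range τ :=
    fun σ => σ.surjective.range_comp τ
  have heq : (fun k => τ (σ k)) = fun k => τ (σ' k) :=
    (m1.range_inj m2).1 ((hr σ).trans (hr σ').symm)
  have hinj : Function.Injective τ := by
    intro i j hij
    obtain ⟨k, rfl⟩ := σ.surjective i
    obtain ⟨l, rfl⟩ := σ.surjective j
    rw [m1.injective hij]
  exact Equiv.ext fun k => hinj (congrFun heq k)

/-- The order is found by sorting the default times; pairwise separation then makes consecutive gaps
at least `ε`. -/
theorem compl_failureEvent_subset :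
    (failureEvent α X Z ε)ᶜ ⊆ ⋃ σ : Equiv.Perm (Fin (n + 1)), spacedEvent α X Z ε σ := by
  intro ω h
  rw [compl_failureEvent_iff] at h
  set τ : Fin (n + 1) → ℝ := fun i => defaultTime α X Z i ω with hτ
  refine mem_iUnion.2 ⟨Tuple.sort τ, fun k => ?_⟩
  have hne : Tuple.sort τ k.succ ≠ Tuple.sort τ k.castSucc :=
    fun hk => k.castSucc_lt_succ.ne' ((Tuple.sort τ).injective hk)
  have h1 := h _ _ hne
  have h2 : τ (Tuple.sort τ k.castSucc) ≤ τ (Tuple.sort τ k.succ) :=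
    Tuple.monotone_sort τ k.castSucc_lt_succ.le
  rw [abs_of_nonneg (sub_nonneg.2 h2)] at h1
  linarith

end Perm

/-! ### The four bounds -/

section Bounds

variable {E : Type*} [TopologicalSpace E] [MeasurableSpace E] [OpensMeasurableSpace E]
  {Ω : Type*} [MeasurableSpace Ω] {P : Measure Ω} {K : ℕ}
  {X : ℝ≥0 → Ω → E} {Z : Fin (K + 1) → Ω → ℝ} {α : Fin (K + 1) → E → ℝ} {ε : ℝ}

theorem IsMarket.measurableSet_failureEvent (h : IsMarket P X Z α) (ε : ℝ) :
    MeasurableSet (failureEvent α X Z ε) := by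
  have hm := h.measurable_defaultTime
  have : failureEvent α X Z ε = ⋃ i : Fin K, ⋃ j : Fin K, ⋃ _ : i ≠ j,
      {ω | |defaultTime α X Z i ω - defaultTime α X Z j ω| < ε} := by
    ext ω
    simp only [failureEvent, mem_ofPred_eq, mem_iUnion, exists_prop]
  rw [this]
  exact MeasurableSet.iUnion fun i => MeasurableSet.iUnion fun j => MeasurableSet.iUnion fun _ =>
    measurableSet_lt ((hm i).sub (hm j)).abs measurable_const

variable [IsProbabilityMeasure P]

theorem IsMarket.measureReal_compl_failureEvent (h : IsMarket P X Z α) (ε : ℝ) :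
    P.real (failureEvent α X Z ε)ᶜ = 1 - P.real (failureEvent α X Z ε) :=
  probReal_compl_eq_one_sub (h.measurableSet_failureEvent ε)

theorem IsMarket.measureReal_pair (h : IsMarket P X Z α) (hε : 0 < ε) {i j : Fin K} (hij : i ≠ j) :
    Integrable (fun ω => pairIntegral (α i.succ) (α j.succ) (α 0) ε (fun t => X t ω)) P ∧
    P.real (spacedEvent α X Z ε ![i, j]) =
      ∫ ω, pairIntegral (α i.succ) (α j.succ) (α 0) ε (fun t => X t ω) ∂P := by
  simpa [pairIntegral_eq_orderedIntegral] using h.measureReal_spacedEvent hε (injective_pair hij)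

theorem IsMarket.measureReal_le_abs_sub (h : IsMarket P X Z α) (hε : 0 < ε) {i j : Fin K}
    (hij : i ≠ j) :
    P.real {ω | ε ≤ |defaultTime α X Z i ω - defaultTime α X Z j ω|} =
      (∫ ω, pairIntegral (α i.succ) (α j.succ) (α 0) ε (fun t => X t ω) ∂P) +
      ∫ ω, pairIntegral (α j.succ) (α i.succ) (α 0) ε (fun t => X t ω) ∂P := by
  have : {ω | ε ≤ |defaultTime α X Z i ω - defaultTime α X Z j ω|} =
      spacedEvent α X Z ε ![i, j] ∪ spacedEvent α X Z ε ![j, i] :=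
    Set.ext fun ω => le_abs_sub_defaultTime_iff
  rw [this, measureReal_union (disjoint_spacedEvent_pair hε i j)
    (h.measurableSet_spacedEvent ε _), (h.measureReal_pair hε hij).2,
    (h.measureReal_pair hε hij.symm).2]

theorem IsMarket.failure_le_choose_two_sub (h : IsMarket P X Z α) (hε : 0 < ε) :
    P.real (failureEvent α X Z ε) ≤ (K.choose 2 : ℝ) - ∑ i : Fin K, ∑ j : Fin K with j ≠ i,
      ∫ ω, pairIntegral (α i.succ) (α j.succ) (α 0) ε (fun t => X t ω) ∂P := by
  rw [choose_two_sub_sum_sum_ne]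
  set F : Fin K → Fin K → Set Ω :=
    fun i j => {ω | ε ≤ |defaultTime α X Z i ω - defaultTime α X Z j ω|}ᶜ with hF
  have hsub : failureEvent α X Z ε ⊆
      ⋃ i ∈ (Finset.univ : Finset (Fin K)), ⋃ j ∈ Finset.univ.filter (i < ·), F i j := by
    rintro ω ⟨i, j, hij, hω⟩
    simp only [hF, Finset.mem_univ, Finset.mem_filter, true_and, iUnion_true, mem_iUnion,
      mem_compl_iff, mem_ofPred_eq, not_le, exists_prop]
    rcases lt_or_gt_of_ne hij with hlt | hlt
    · exact ⟨i, j, hlt, hω⟩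
    · exact ⟨j, i, hlt, by rwa [abs_sub_comm]⟩
  refine (measureReal_mono hsub (measure_ne_top _ _)).trans <| (measureReal_biUnion_finset_le _ _).trans <|
    Finset.sum_le_sum fun i _ => (measureReal_biUnion_finset_le _ _).trans <|
      Finset.sum_le_sum fun j hj => le_of_eq ?_
  have hij : i ≠ j := (Finset.mem_filter.1 hj).2.ne
  have hm : MeasurableSet {ω | ε ≤ |defaultTime α X Z i ω - defaultTime α X Z j ω|} :=
    measurableSet_le measurable_const
      ((h.measurable_defaultTime i).sub (h.measurable_defaultTime j)).abs
  rw [hF, probReal_compl_eq_one_sub hm, h.measureReal_le_abs_sub hε hij]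

theorem IsMarket.one_sub_le_failure_of_pair (h : IsMarket P X Z α) (hε : 0 < ε) {i j : Fin K}
    (hij : i ≠ j) :
    1 - ∫ ω, (pairIntegral (α i.succ) (α j.succ) (α 0) ε (fun t => X t ω) +
        pairIntegral (α j.succ) (α i.succ) (α 0) ε (fun t => X t ω)) ∂P ≤
      P.real (failureEvent α X Z ε) := by
  rw [integral_add (h.measureReal_pair hε hij).1 (h.measureReal_pair hε hij.symm).1,
    ← h.measureReal_le_abs_sub hε hij, sub_le_comm, ← h.measureReal_compl_failureEvent]
  exact measureReal_mono fun ω hω => compl_failureEvent_iff.1 hω i j hij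

end Bounds

section PermBounds

variable {E : Type*} [TopologicalSpace E] [MeasurableSpace E] [OpensMeasurableSpace E]
  {Ω : Type*} [MeasurableSpace Ω] {P : Measure Ω} [IsProbabilityMeasure P] {n : ℕ}
  {X : ℝ≥0 → Ω → E} {Z : Fin (n + 2) → Ω → ℝ} {α : Fin (n + 2) → E → ℝ} {ε : ℝ}

theorem IsMarket.failure_le_one_sub_orderedIntegral (h : IsMarket P X Z α) (hε : 0 < ε)
    (S : Finset (Equiv.Perm (Fin (n + 1)))) :
    P.real (failureEvent α X Z ε) ≤ 1 - ∫ ω, ∑ σ ∈ S, orderedIntegral (α 0) ε (fun t => X t ω)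
      (List.ofFn fun m => α (σ m).succ) 0 ∂P := by
  rw [integral_finsetSum _ fun σ _ => (h.measureReal_spacedEvent hε σ.injective).1,
    ← Finset.sum_congr rfl fun σ _ => (h.measureReal_spacedEvent hε σ.injective).2,
    ← measureReal_biUnion_finset (fun σ _ σ' _ hne => disjoint_spacedEvent_perm hε hne)
      fun σ _ => h.measurableSet_spacedEvent ε σ, le_sub_comm, ← h.measureReal_compl_failureEvent]
  exact measureReal_mono (iUnion₂_subset fun σ _ => spacedEvent_perm_subset hε σ)

theorem IsMarket.one_sub_le_failure (h : IsMarket P X Z α) (hε : 0 < ε) :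
    1 - ∫ ω, Real.exp (-cumIntensity (α 0) (fun t => X t ω) (n * ε)) *
        ∑ σ : Equiv.Perm (Fin (n + 1)), Real.exp (-∑ m : Fin (n + 1) with 0 < m.val,
          cumIntensity (α (σ m).succ) (fun t => X t ω) (m.val * ε)) ∂P ≤
      P.real (failureEvent α X Z ε) := by
  simp only [Finset.mul_sum]
  rw [integral_finsetSum _ fun σ _ => (h.measureReal_spacedEvent_le hε
    (Equiv.injective σ)).1, sub_le_comm, ← h.measureReal_compl_failureEvent]
  refine (measureReal_mono compl_failureEvent_subset).trans <|
    (measureReal_iUnion_fintype_le _).trans ?_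
  exact Finset.sum_le_sum fun σ _ => (h.measureReal_spacedEvent_le hε σ.injective).2

end PermBounds

end MarketFailure

theorem mainTheorem5
    {Ω : Type*} [MeasurableSpace Ω] (P : Measure Ω) [IsProbabilityMeasure P]
    (d K : ℕ) (hK : 2 ≤ K)
    -- the state process `X`: càdlàg, with values in `ℝᵈ`
    (X : ℝ≥0 → Ω → EuclideanSpace ℝ (Fin d))
    (hXmeas : ∀ t, Measurable (X t))
    (hXpath : ∀ ω, MarketFailure.IsCadlag (fun t => X t ω))
    -- unit exponential variables, independent of each other and of the process `X`
    (Z : Fin (K + 1) → Ω → ℝ)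
    (hZmeas : ∀ i, Measurable (Z i))
    (hZlaw : ∀ i, P.map (Z i) = expMeasure 1)
    (hZindep : iIndepFun Z P)
    (hXZ : IndepFun (fun ω (t : ℝ≥0) => X t ω) (fun ω (i : Fin (K + 1)) => Z i ω) P)
    -- the intensities; index `0` is the market-wide stress event
    (α : Fin (K + 1) → EuclideanSpace ℝ (Fin d) → ℝ)
    (hαcont : ∀ i, Continuous (α i))
    (hαnonneg : ∀ i x, 0 ≤ α i x)
    (hA : ∀ i, ∀ᵐ ω ∂P,
      Tendsto (MarketFailure.cumIntensity (α i) (fun t => X t ω)) atTop atTop)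
    (ε : ℝ) (hε : 0 < ε)
    (S : Finset (Equiv.Perm (Fin K))) :
    P.real (MarketFailure.failureEvent α X Z ε) ≤
      min
        ((K.choose 2 : ℝ) - ∑ i : Fin K, ∑ j : Fin K with j ≠ i,
          ∫ ω, MarketFailure.pairIntegral (α i.succ) (α j.succ) (α 0) ε (fun t => X t ω) ∂P)
        (1 - ∫ ω, ∑ σ ∈ S, MarketFailure.orderedIntegral (α 0) ε (fun t => X t ω)
          (List.ofFn fun m : Fin K => α (σ m).succ) 0 ∂P) ∧
    max
        (1 - ∫ ω, Real.exp (-MarketFailure.cumIntensity (α 0) (fun t => X t ω) ((K - 1 : ℝ) * ε)) *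
          ∑ σ : Equiv.Perm (Fin K), Real.exp (-∑ m : Fin K with 0 < m.val,
            MarketFailure.cumIntensity (α (σ m).succ) (fun t => X t ω) (m.val * ε)) ∂P)
        (1 - (MarketFailure.bankPairs K).inf' (MarketFailure.bankPairs_nonempty hK) fun p =>
          ∫ ω, (MarketFailure.pairIntegral (α p.1.succ) (α p.2.succ) (α 0) ε (fun t => X t ω) +
            MarketFailure.pairIntegral (α p.2.succ) (α p.1.succ) (α 0) ε (fun t => X t ω)) ∂P)
      ≤ P.real (MarketFailure.failureEvent α X Z ε) := by
  have h : MarketFailure.IsMarket P X Z α :=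
    ⟨hXmeas, hXpath, hZmeas, hZlaw, hZindep, hXZ, hαcont, hαnonneg, hA⟩
  obtain ⟨n, rfl⟩ : ∃ n, K = n + 1 := ⟨K - 1, by omega⟩
  refine ⟨le_min (h.failure_le_choose_two_sub hε) (h.failure_le_one_sub_orderedIntegral hε S),
    max_le ?_ ?_⟩
  · simpa only [Nat.cast_add, Nat.cast_one, add_sub_cancel_right] using h.one_sub_le_failure hε
  -- Moving the minimum to the right-hand side reduces the claim to one inequality per pair.
  · rw [sub_le_comm]
    refine Finset.le_inf' _ _ fun p hp => ?_
    rw [sub_le_comm]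
    exact h.one_sub_le_failure_of_pair hε (Finset.mem_offDiag.1 hp).2.2
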